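/- Let $g=\frac{\sqrt5-1}{2}$. For $\alpha\in(0,1]$ put $\bar\alpha=\max(\alpha,1-\alpha)$ and let $A_\alpha:[0,\bar\alpha]\to[0,\bar\alpha]$ be Nakada's $\alpha$-continued fraction map, $A_\alpha(0)=0$ and $$A_\alpha(x)=\left|\frac1x-\left\lfloor\frac1x+1-\alpha\right\rfloor\right|\qquad(0<x\le\bar\alpha).$$ For $x\in\mathbb R\setminus\mathbb Q$ put $x_{\alpha,0}=\left|x-\lfloor x+1-\bar\alpha\rfloor\right|$, $x_{\alpha,j}=A_\alpha^j(x_{\alpha,0})$, $\beta_{\alpha,-1}(x)=1$ and $\beta_{\alpha,j}(x)=x_{\alpha,0}x_{\alpha,1}\cdots x_{\alpha,j}$ for $j\ge0$. The Wilton function is $$W_\alpha(x)=\sum_{j=0}^{\infty}(-1)^j\beta_{\alpha,j-1}(x)\log\frac1{x_{\alpha,j}},$$ defined at those $x$ at which the sequence of partial sums of the series converges. A function $f:\mathbb R\to\mathbb R$ (defined almost everywhere) is in $\mathrm{BMO}$ if it is locally integrable and $$\sup_{a<b}\ \frac1{b-a}\int_a^b\left|f(x)-\frac1{b-a}\int_a^b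 f(y)\,dy\right|dx<\infty .$$ **Theorem.** For every $\alpha\in[1-g,g]$ the series defining $W_\alpha$ converges at almost every $x\in\mathbb R$, and $W_\alpha\in\mathrm{BMO}$. -/

import Mathlib

open MeasureTheory Filter Topology

noncomputable section

namespace Wilton

/-- The number `g = (√5 - 1) / 2`. -/
def g : ℝ := (Real.sqrt 5 - 1) / 2

/-- The (folded) Nakada map `A_α(x) = |1/x - [1/x + 1 - α]|` for `x ≠ 0`, with `A_α(0) = 0`. -/
def nakadaMap (α x : ℝ) : ℝ :=
  if x = 0 then 0 else |1 / x - (⌊1 / x + 1 - α⌋ : ℝ)|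

/-- The starting point `x_{α,0} = |x - [x + 1 - ᾱ]|`, where `ᾱ = max α (1 - α)`. -/
def startPoint (α x : ℝ) : ℝ := |x - (⌊x + 1 - max α (1 - α)⌋ : ℝ)|

/-- The orbit `x_{α,j} = A_α^j (x_{α,0})`. -/
def orbitPoint (α x : ℝ) (j : ℕ) : ℝ := (nakadaMap α)^[j] (startPoint α x)

/-- The product `x_{α,0} ⋯ x_{α,j-1}` of the first `j` points of the orbit,
that is, `β_{α,j-1}(x)`; for `j = 0` it is `β_{α,-1} = 1`. -/
def betaPrev (α x : ℝ) (j : ℕ) : ℝ := ∏ i ∈ Finset.range j, orbitPoint α x i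

/-- The `j`-th term `(-1)^j β_{α,j-1}(x) log (1 / x_{α,j})` of the Wilton series. -/
def wiltonTerm (α x : ℝ) (j : ℕ) : ℝ :=
  (-1) ^ j * betaPrev α x j * Real.log (1 / orbitPoint α x j)

/-- The sum of the first `N` terms of the Wilton series. -/
def wiltonPartialSum (α : ℝ) (N : ℕ) (x : ℝ) : ℝ := ∑ j ∈ Finset.range N, wiltonTerm α x j

/-- The Wilton series of `x` converges, i.e. its sequence of partial sums has a finite limit
(no absolute convergence is required). -/
def WiltonConverges (α x : ℝ) : Prop :=
  ∃ l : ℝ, Tendsto (fun N => wiltonPartialSum α N x) atTop (𝓝 l)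

/-- The Wilton function `W_α`: the limit of the partial sums of the Wilton series
(the value has no meaning where the series diverges). -/
def wiltonFunction (α x : ℝ) : ℝ := limUnder atTop (fun N => wiltonPartialSum α N x)

/-- `f` is a function of bounded mean oscillation on the real line: it is locally integrable and
its mean oscillations over all bounded intervals are bounded by one constant. -/
def MemBMO (f : ℝ → ℝ) : Prop :=
  LocallyIntegrable f volume ∧
    ∃ C : ℝ, ∀ a b : ℝ, a < b → (⨍ x in a..b, |f x - ⨍ y in a..b, f y|) ≤ C

end Wilton

end

/-!
Let `w` be an even function of period `1`, integrable over a period, with `-log x ≤ w x` and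
`x w(1/x) ≤ (9/10) w x` on `(0, g]`. All the maps `A_α` preserve `[0, g]` and satisfy
`w (A_α x) = w (1/x)`, so along every orbit the terms of the series decay geometrically; hence it
converges wherever `w` is finite, and `|W_α| ≤ 10 w`. Such a `w` is a Neumann series.

The function `F = W_{1/2}` is even and periodic and satisfies `F x = -log x - x F(1/x)` on
`(0, 1/2]`. There the inversion lengthens intervals by a factor of at least `4`, so the equation
bounds the mean oscillation of `F` over a short interval by that over a longer one.

Finally `W_α - F` is bounded: the defect `F x + log x + x F(1/x)` is bounded on `(0, g]`, and
substituting for `-log x_j` in `W_α` makes the sum telescope, up to `∑ β_{j-1} |defect| ≤ 8 ∑ gʲ`.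
-/

noncomputable section

namespace Wilton

open scoped ENNReal Pointwise

/-! ### The golden mean -/

theorem g_sq : g ^ 2 = 1 - g := by
  unfold g
  nlinarith [Real.sq_sqrt (show (0 : ℝ) ≤ 5 by norm_num)]

theorem half_lt_g : 1 / 2 < g := by
  have : (2 : ℝ) < Real.sqrt 5 := Real.lt_sqrt_of_sq_lt (by norm_num)
  unfold g
  linarith

theorem g_pos : 0 < g := one_half_pos.trans half_lt_g

theorem g_lt_two_thirds : g < 2 / 3 := by nlinarith [g_sq, g_pos]

theorem inv_g : g⁻¹ = 1 + g :=
  inv_eq_of_mul_eq_one_right (by linarith [g_sq])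

/-! ### Even periodic functions -/

/-- Even functions of period `1`: these are the functions that do not distinguish `x` from `|x - n|`
for an integer `n`, hence are compatible with the folded continued fraction maps. -/
structure EvenPeriodic {β : Type*} (f : ℝ → β) : Prop where
  periodic : Function.Periodic f 1
  even : Function.Even f

namespace EvenPeriodic

variable {β : Type*} {f : ℝ → β}

theorem sub_intCast (hf : EvenPeriodic f) (x : ℝ) (n : ℤ) : f (x - n) = f x := by
  simpa only [mul_one] using hf.periodic.sub_int_mul_eq (x := x) n

theorem intCast_sub (hf : EvenPeriodic f) (n : ℤ) (x : ℝ) : f (n - x) = f x := by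
  rw [← hf.even, neg_sub, hf.sub_intCast]

theorem abs_sub_intCast (hf : EvenPeriodic f) (x : ℝ) (n : ℤ) : f |x - n| = f x := by
  rcases abs_choice (x - n) with h | h <;> rw [h]
  · exact hf.sub_intCast x n
  · rw [neg_sub, hf.intCast_sub]

theorem comp {γ : Type*} (hf : EvenPeriodic f) (k : β → γ) : EvenPeriodic fun x => k (f x) :=
  ⟨fun x => congrArg k (hf.periodic x), fun x => congrArg k (hf.even x)⟩

end EvenPeriodic

/-! ### Integrals of periodic functions -/

section Periodic

variable {f : ℝ → ℝ≥0∞}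

theorem setLIntegral_Icc_add_one (hf : Function.Periodic f 1) (a : ℝ) :
    ∫⁻ x in Set.Icc a (a + 1), f x = ∫⁻ x in Set.Ioc (0 : ℝ) 1, f x := by
  have hdom := isAddFundamentalDomain_Ioc (one_pos (α := ℝ)) 0
  rw [zero_add] at hdom
  rw [setLIntegral_congr Ioc_ae_eq_Icc.symm]
  refine (isAddFundamentalDomain_Ioc one_pos a).setLIntegral_eq hdom f ?_
  rintro ⟨z, hz⟩ x
  obtain ⟨n, rfl⟩ := AddSubgroup.mem_zmultiples_iff.1 hz
  rw [AddSubgroup.mk_vadd, vadd_eq_add, add_comm, hf.zsmul n x]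

theorem mem_Icc_add_floor {a y : ℝ} (hy : a ≤ y) :
    y ∈ Set.Icc (a + ⌊y - a⌋₊) (a + ⌊y - a⌋₊ + 1) :=
  ⟨by linarith [Nat.floor_le (sub_nonneg.2 hy)], by linarith [Nat.lt_floor_add_one (y - a)]⟩

theorem setLIntegral_Icc_le (hf : Function.Periodic f 1) {a b : ℝ} (hab : a ≤ b) :
    ∫⁻ x in Set.Icc a b, f x ≤ ENNReal.ofReal (b - a + 1) * ∫⁻ x in Set.Ioc (0 : ℝ) 1, f x := by
  set N := ⌊b - a⌋₊ + 1 with hN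
  have hcover : Set.Icc a b ⊆ ⋃ i : Fin N, Set.Icc (a + (i : ℕ)) (a + (i : ℕ) + 1) := fun y hy =>
    Set.mem_iUnion.2 ⟨⟨⌊y - a⌋₊, by have := hy.2; rw [hN, Nat.lt_succ_iff]; gcongr⟩,
      mem_Icc_add_floor hy.1⟩
  calc ∫⁻ x in Set.Icc a b, f x
      ≤ ∑' i : Fin N, ∫⁻ x in Set.Icc (a + (i : ℕ)) (a + (i : ℕ) + 1), f x :=
        (lintegral_mono_set hcover).trans (lintegral_iUnion_le _ _)
    _ = N * ∫⁻ x in Set.Ioc (0 : ℝ) 1, f x := by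
        simp only [setLIntegral_Icc_add_one hf, tsum_fintype, Finset.sum_const, Finset.card_univ,
          Fintype.card_fin, nsmul_eq_mul]
    _ ≤ _ := by
        rw [← ENNReal.ofReal_natCast, hN]
        push_cast
        gcongr
        exact Nat.floor_le (sub_nonneg.2 hab)

theorem setLIntegral_Ioi_antitone_mul_le (hf : Function.Periodic f 1) {φ : ℝ → ℝ} {a : ℝ}
    (hφ : AntitoneOn φ (Set.Ici a)) :
    ∫⁻ y in Set.Ioi a, ENNReal.ofReal (φ y) * f y ≤
      (∑' n : ℕ, ENNReal.ofReal (φ (a + n))) * ∫⁻ x in Set.Ioc (0 : ℝ) 1, f x := by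
  have hcover : Set.Ioi a ⊆ ⋃ n : ℕ, Set.Icc (a + n) (a + n + 1) := fun y hy =>
    Set.mem_iUnion.2 ⟨_, mem_Icc_add_floor (le_of_lt hy)⟩
  calc ∫⁻ y in Set.Ioi a, ENNReal.ofReal (φ y) * f y
      ≤ ∑' n : ℕ, ∫⁻ y in Set.Icc (a + n) (a + n + 1), ENNReal.ofReal (φ y) * f y :=
        (lintegral_mono_set hcover).trans (lintegral_iUnion_le _ _)
    _ ≤ ∑' n : ℕ, ENNReal.ofReal (φ (a + n)) * ∫⁻ x in Set.Ioc (0 : ℝ) 1, f x := by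
        refine ENNReal.tsum_le_tsum fun n => ?_
        rw [← setLIntegral_Icc_add_one hf (a + n), ← lintegral_const_mul' _ _ ENNReal.ofReal_ne_top]
        refine setLIntegral_mono' measurableSet_Icc fun y hy => ?_
        have han : a ≤ a + n := le_add_of_nonneg_right n.cast_nonneg
        gcongr
        exact hφ han (han.trans hy.1) hy.1
    _ = _ := ENNReal.tsum_mul_right

end Periodic

theorem EvenPeriodic.setLIntegral_sub_intCast {f : ℝ → ℝ≥0∞} (hf : EvenPeriodic f) (a b : ℝ)
    (n : ℤ) : ∫⁻ x in Set.Icc (a - n) (b - n), f x = ∫⁻ x in Set.Icc a b, f x := by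
  rw [← lintegral_indicator measurableSet_Icc, ← lintegral_indicator measurableSet_Icc,
    ← lintegral_sub_right_eq_self _ (n : ℝ)]
  congr 1 with x
  simp only [Set.indicator_apply, Set.mem_Icc, sub_le_sub_iff_right, hf.sub_intCast]

theorem EvenPeriodic.setLIntegral_intCast_sub {f : ℝ → ℝ≥0∞} (hf : EvenPeriodic f) (a b : ℝ)
    (n : ℤ) : ∫⁻ x in Set.Icc (n - b) (n - a), f x = ∫⁻ x in Set.Icc a b, f x := by
  rw [← lintegral_indicator measurableSet_Icc, ← lintegral_indicator measurableSet_Icc,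
    ← lintegral_sub_left_eq_self _ (n : ℝ)]
  congr 1 with x
  simp only [Set.indicator_apply, Set.mem_Icc, sub_le_sub_iff_left, hf.intCast_sub, and_comm]

theorem locallyIntegrable_of_enorm_le {f : ℝ → ℝ} {k : ℝ → ℝ≥0∞}
    (hf : AEStronglyMeasurable f volume) (hk : Function.Periodic k 1)
    (hkint : ∫⁻ x in Set.Ioc (0 : ℝ) 1, k x ≠ ∞) (hfk : ∀ᵐ x, ‖f x‖ₑ ≤ k x) :
    LocallyIntegrable f volume := by
  refine fun x => ⟨Set.Icc (x - 1) (x + 1), Icc_mem_nhds (by linarith) (by linarith),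
    hf.restrict, ?_⟩
  calc ∫⁻ y in Set.Icc (x - 1) (x + 1), ‖f y‖ₑ
      ≤ ∫⁻ y in Set.Icc (x - 1) (x + 1), k y := lintegral_mono_ae (ae_restrict_of_ae hfk)
    _ ≤ ENNReal.ofReal (x + 1 - (x - 1) + 1) * ∫⁻ y in Set.Ioc (0 : ℝ) 1, k y :=
        setLIntegral_Icc_le hk (by linarith)
    _ < ∞ := ENNReal.mul_lt_top ENNReal.ofReal_lt_top hkint.lt_top

/-! ### The inversion `x ↦ x⁻¹` -/

theorem setLIntegral_inv {s : Set ℝ} (hs : MeasurableSet s) (hpos : s ⊆ Set.Ioi 0)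
    (f : ℝ → ℝ≥0∞) :
    ∫⁻ x in s⁻¹, f x = ∫⁻ y in s, ENNReal.ofReal (y ^ 2)⁻¹ * f y⁻¹ := by
  rw [← Set.image_inv_eq_inv, lintegral_image_eq_lintegral_abs_deriv_mul hs
    (fun y hy => (hasDerivAt_inv (hpos hy).ne').hasDerivWithinAt) inv_injective.injOn]
  simp only [abs_neg, abs_inv, abs_pow, sq_abs]

theorem setLIntegral_Icc_comp_inv_le {a b : ℝ} (ha : 0 < a) (hab : a ≤ b) (f : ℝ → ℝ≥0∞) :
    ∫⁻ x in Set.Icc a b, f x⁻¹ ≤ ENNReal.ofReal (b ^ 2) * ∫⁻ y in Set.Icc b⁻¹ a⁻¹, f y := by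
  have hb : 0 < b := ha.trans_le hab
  have hpos : Set.Icc b⁻¹ a⁻¹ ⊆ Set.Ioi 0 := fun y hy => (inv_pos.2 hb).trans_le hy.1
  have hsub : Set.Icc a b ⊆ (Set.Icc b⁻¹ a⁻¹)⁻¹ := fun x hx =>
    ⟨inv_anti₀ (ha.trans_le hx.1) hx.2, inv_anti₀ ha hx.1⟩
  refine (lintegral_mono_set hsub).trans ?_
  rw [setLIntegral_inv measurableSet_Icc hpos, ← lintegral_const_mul' _ _ ENNReal.ofReal_ne_top]
  refine setLIntegral_mono' measurableSet_Icc fun y hy => ?_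
  rw [inv_inv]
  gcongr
  exact inv_le_of_inv_le₀ (by positivity) (by rw [← inv_pow]; have := hy.1; gcongr)

theorem tsum_ofReal_le_of_le_sub {u v : ℕ → ℝ} (hu : ∀ n, 0 ≤ u n) (hv : ∀ n, 0 ≤ v n)
    (huv : ∀ n, u n ≤ v n - v (n + 1)) : ∑' n, ENNReal.ofReal (u n) ≤ ENNReal.ofReal (v 0) := by
  refine ENNReal.tsum_le_of_sum_range_le fun N => ?_
  rw [← ENNReal.ofReal_sum_of_nonneg fun n _ => hu n]
  refine ENNReal.ofReal_le_ofReal ((Finset.sum_le_sum fun n _ => huv n).trans ?_)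
  rw [Finset.sum_range_sub']
  linarith [hv N]

/-- Convexity of `t ↦ t⁻³` bounds each term by the telescoping difference
`∫ t⁻³ dt` over the unit interval centred at `a + n`. -/
theorem tsum_inv_cube_le {a : ℝ} (ha : 1 / 2 < a) :
    ∑' n : ℕ, ENNReal.ofReal ((a + n)⁻¹ ^ 3) ≤ ENNReal.ofReal ((2 * (a - 1 / 2) ^ 2)⁻¹) := by
  have hterm : ∀ t : ℝ, 1 / 2 < t →
      t⁻¹ ^ 3 ≤ (2 * (t - 1 / 2) ^ 2)⁻¹ - (2 * (t + 1 - 1 / 2) ^ 2)⁻¹ := by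
    intro t ht
    have : 0 < t - 1 / 2 := by linarith
    have hdiff : (2 * (t - 1 / 2) ^ 2)⁻¹ - (2 * (t + 1 - 1 / 2) ^ 2)⁻¹ =
        t / ((t - 1 / 2) * (t + 1 / 2)) ^ 2 := by
      rw [show t + 1 - 1 / 2 = t + 1 / 2 by ring, inv_sub_inv (by positivity) (by positivity),
        div_eq_div_iff (by positivity) (by positivity)]
      ring
    rw [hdiff, inv_pow, inv_eq_one_div, div_le_div_iff₀ (by positivity) (by positivity), one_mul,
      show t * t ^ 3 = (t ^ 2) ^ 2 by ring]
    gcongr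
    nlinarith
  have := tsum_ofReal_le_of_le_sub (u := fun n : ℕ => (a + n)⁻¹ ^ 3)
    (v := fun n : ℕ => (2 * (a + n - 1 / 2) ^ 2)⁻¹) (fun n => by positivity)
    (fun n => by positivity) fun n => by
      have := hterm (a + n) (by linarith [n.cast_nonneg (α := ℝ)])
      push_cast
      rwa [← add_assoc]
  simpa only [CharP.cast_eq_zero, add_zero] using this

theorem setLIntegral_mul_comp_inv_le {f : ℝ → ℝ≥0∞} (hf : Function.Periodic f 1) {b : ℝ}
    (hb : 0 < b) (hb' : b < 2) :
    ∫⁻ x in Set.Ioc 0 b, ENNReal.ofReal x * f x⁻¹ ≤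
      ENNReal.ofReal ((2 * (b⁻¹ - 1 / 2) ^ 2)⁻¹) * ∫⁻ x in Set.Ioc (0 : ℝ) 1, f x := by
  have hb0 : 0 < b⁻¹ := inv_pos.2 hb
  have hanti : AntitoneOn (fun y : ℝ => y⁻¹ ^ 3) (Set.Ici b⁻¹) := fun x hx y _ hxy => by
    have hx0 : 0 < x := hb0.trans_le hx
    exact pow_le_pow_left₀ (inv_nonneg.2 (hx0.le.trans hxy)) (inv_anti₀ hx0 hxy) 3
  calc ∫⁻ x in Set.Ioc 0 b, ENNReal.ofReal x * f x⁻¹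
      = ∫⁻ x in (Set.Ioi b⁻¹)⁻¹, ENNReal.ofReal x * f x⁻¹ := by
        rw [Set.inv_Ioi₀ hb0, inv_inv, setLIntegral_congr Ioo_ae_eq_Ioc]
    _ = ∫⁻ y in Set.Ioi b⁻¹, ENNReal.ofReal (y⁻¹ ^ 3) * f y := by
        rw [setLIntegral_inv measurableSet_Ioi (Set.Ioi_subset_Ioi hb0.le)]
        refine setLIntegral_congr_fun measurableSet_Ioi fun y _ => ?_
        rw [inv_inv, ← mul_assoc, ← ENNReal.ofReal_mul (by positivity), ← inv_pow, ← pow_succ]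
    _ ≤ (∑' n : ℕ, ENNReal.ofReal ((b⁻¹ + n)⁻¹ ^ 3)) * ∫⁻ x in Set.Ioc (0 : ℝ) 1, f x :=
        setLIntegral_Ioi_antitone_mul_le hf hanti
    _ ≤ _ := by
        gcongr
        exact tsum_inv_cube_le (by rw [one_div]; gcongr)

/-! ### Mean oscillation -/

/-- The mean oscillation of `f` over `[a, b]` about some constant is at most `M`. An arbitrary
constant is as good as the mean of `f` up to a factor `2`, and spares computing the means over the
images of an interval. -/
def MeanOscLE (f : ℝ → ℝ) (a b : ℝ) (M : ℝ≥0∞) : Prop :=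
  ∃ c : ℝ, ∫⁻ x in Set.Icc a b, ‖f x - c‖ₑ ≤ M * ENNReal.ofReal (b - a)

namespace MeanOscLE

variable {f h : ℝ → ℝ} {a b : ℝ} {M M' K : ℝ≥0∞}

theorem mono (hf : MeanOscLE f a b M) (hM : M ≤ M') : MeanOscLE f a b M' :=
  let ⟨c, hc⟩ := hf
  ⟨c, hc.trans (by gcongr)⟩

theorem of_enorm_sub_le (hf : MeanOscLE f a b M) (hfh : ∀ᵐ x, ‖h x - f x‖ₑ ≤ K) :
    MeanOscLE h a b (K + M) := by
  obtain ⟨c, hc⟩ := hf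
  refine ⟨c, ?_⟩
  calc ∫⁻ x in Set.Icc a b, ‖h x - c‖ₑ
      ≤ ∫⁻ x in Set.Icc a b, (K + ‖f x - c‖ₑ) := by
        refine lintegral_mono_ae (ae_restrict_of_ae (hfh.mono fun x hx => ?_))
        rw [← sub_add_sub_cancel (h x) (f x) c]
        exact (enorm_add_le _ _).trans (by gcongr)
    _ = K * ENNReal.ofReal (b - a) + ∫⁻ x in Set.Icc a b, ‖f x - c‖ₑ := by
        rw [lintegral_add_left measurable_const, setLIntegral_const, Real.volume_Icc]
    _ ≤ _ := by
        rw [add_mul]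
        gcongr

end MeanOscLE

namespace EvenPeriodic

variable {f : ℝ → ℝ} {a b : ℝ} {M : ℝ≥0∞}

theorem meanOscLE_sub_intCast (hf : EvenPeriodic f) (n : ℤ) :
    MeanOscLE f (a - n) (b - n) M ↔ MeanOscLE f a b M := by
  refine exists_congr fun c => ?_
  rw [(hf.comp fun y => ‖y - c‖ₑ).setLIntegral_sub_intCast, sub_sub_sub_cancel_right]

theorem meanOscLE_neg (hf : EvenPeriodic f) :
    MeanOscLE f (-b) (-a) M ↔ MeanOscLE f a b M := by
  refine exists_congr fun c => ?_
  have := (hf.comp fun y => ‖y - c‖ₑ).setLIntegral_intCast_sub a b 0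
  simp only [Int.cast_zero, zero_sub] at this
  rw [this, neg_sub_neg]

theorem meanOscLE_of_midpoint (hf : EvenPeriodic f)
    (h : ∀ a' b', b' - a' = b - a → 0 ≤ a' + b' → a' + b' ≤ 1 → MeanOscLE f a' b' M) :
    MeanOscLE f a b M := by
  set m := (a + b) / 2 with hmdef
  have hm := abs_le.1 (abs_sub_round m)
  rw [← hf.meanOscLE_sub_intCast (round m)]
  rcases le_total 0 (m - round m) with h0 | h0
  · exact h _ _ (by ring) (by linarith) (by linarith)
  · rw [← hf.meanOscLE_neg]
    exact h _ _ (by ring) (by linarith) (by linarith)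

end EvenPeriodic

theorem abs_intervalAverage_sub_le {f : ℝ → ℝ} {a b : ℝ} (hab : a < b)
    (hf : IntervalIntegrable f volume a b) (c : ℝ) :
    |(⨍ x in a..b, f x) - c| ≤ ⨍ x in a..b, |f x - c| := by
  have hba : 0 < b - a := sub_pos.2 hab
  have hmean : (⨍ x in a..b, f x) - c = (∫ x in a..b, (f x - c)) / (b - a) := by
    rw [intervalIntegral.integral_sub hf intervalIntegrable_const, intervalIntegral.integral_const,
      interval_average_eq_div, smul_eq_mul, sub_div, mul_div_cancel_left₀ _ hba.ne']
  rw [hmean, abs_div, abs_of_pos hba, interval_average_eq_div]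
  gcongr
  exact intervalIntegral.abs_integral_le_integral_abs hab.le

theorem intervalAverage_abs_sub_average_le {f : ℝ → ℝ} {a b : ℝ} (hab : a < b)
    (hf : IntervalIntegrable f volume a b) (c : ℝ) :
    (⨍ x in a..b, |f x - ⨍ y in a..b, f y|) ≤ 2 * ⨍ x in a..b, |f x - c| := by
  have hba : 0 < b - a := sub_pos.2 hab
  have hfc : IntervalIntegrable (fun x => |f x - c|) volume a b :=
    (hf.sub intervalIntegrable_const).abs
  have hA := abs_intervalAverage_sub_le hab hf c
  set A := ⨍ y in a..b, f y
  set m := ⨍ x in a..b, |f x - c| with hm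
  calc ⨍ x in a..b, |f x - A| ≤ (∫ x in a..b, (|f x - c| + m)) / (b - a) := by
        rw [interval_average_eq_div]
        gcongr
        refine intervalIntegral.integral_mono_on hab.le (hf.sub intervalIntegrable_const).abs
          (hfc.add intervalIntegrable_const) fun x _ => (abs_sub_le _ c _).trans ?_
        rw [abs_sub_comm c A]
        gcongr
    _ = 2 * m := by
        rw [intervalIntegral.integral_add hfc intervalIntegrable_const,
          intervalIntegral.integral_const, smul_eq_mul, add_div, mul_div_cancel_left₀ _ hba.ne',
          ← interval_average_eq_div, ← hm, two_mul]

theorem memBMO_of_meanOscLE {f : ℝ → ℝ} (hf : LocallyIntegrable f volume) {M : ℝ≥0∞} (hM : M ≠ ∞)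
    (h : ∀ a b, a < b → MeanOscLE f a b M) : MemBMO f := by
  refine ⟨hf, 2 * M.toReal, fun a b hab => ?_⟩
  obtain ⟨c, hc⟩ := h a b hab
  have hfi : IntervalIntegrable f volume a b :=
    (intervalIntegrable_iff_integrableOn_Icc_of_le hab.le).2
      (hf.integrableOn_isCompact isCompact_Icc)
  refine (intervalAverage_abs_sub_average_le hab hfi c).trans ?_
  have hmeas : AEStronglyMeasurable (fun x => f x - c) (volume.restrict (Set.Icc a b)) :=
    hf.aestronglyMeasurable.restrict.sub aestronglyMeasurable_const
  gcongr
  rw [interval_average_eq_div, div_le_iff₀ (sub_pos.2 hab), intervalIntegral.integral_of_le hab.le,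
    ← integral_Icc_eq_integral_Ioc]
  simp only [← Real.norm_eq_abs]
  rw [integral_norm_eq_lintegral_enorm hmeas]
  refine (ENNReal.toReal_mono (ENNReal.mul_ne_top hM ENNReal.ofReal_ne_top) hc).trans_eq ?_
  rw [ENNReal.toReal_mul, ENNReal.toReal_ofReal (sub_pos.2 hab).le]

/-! ### The functional equation -/

/-- The defect of `F` in the functional equation `F x = -log x - x F(x⁻¹)` of the Wilton
function. -/
def defect (F : ℝ → ℝ) (x : ℝ) : ℝ := F x + Real.log x + x * F x⁻¹

/-- The even periodic functions `f` with `f x = -log x - x f(x⁻¹)` almost everywhere on `(0, 1/2]`;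
the Wilton function of the nearest integer continued fraction is one. -/
structure IsWiltonSolution (f : ℝ → ℝ) : Prop extends EvenPeriodic f where
  aemeasurable : AEMeasurable f volume
  defect_eq_zero : ∀ᵐ x, x ∈ Set.Ioc 0 (1 / 2) → defect f x = 0

/-- One plus the integral of `|f|` over a period, the unit in which oscillations are measured. -/
def periodMass (f : ℝ → ℝ) : ℝ≥0∞ := 1 + ∫⁻ x in Set.Ioc (0 : ℝ) 1, ‖f x‖ₑ

theorem setLIntegral_log_sub_log {b : ℝ} (hb : 0 < b) :
    ∫⁻ x in Set.Ioc 0 b, ENNReal.ofReal (Real.log b - Real.log x) = ENNReal.ofReal b := by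
  have hi : IntervalIntegrable (fun x => Real.log b - Real.log x) volume 0 b :=
    intervalIntegrable_const.sub intervalIntegral.intervalIntegrable_log'
  rw [← ofReal_integral_eq_lintegral_ofReal
    ((intervalIntegrable_iff_integrableOn_Ioc_of_le hb.le).1 hi),
    ← intervalIntegral.integral_of_le hb.le,
    intervalIntegral.integral_sub intervalIntegrable_const
      intervalIntegral.intervalIntegrable_log', integral_log]
  · simp
  · exact (ae_restrict_iff' measurableSet_Ioc).2
      (ae_of_all _ fun x hx => sub_nonneg.2 (Real.log_le_log hx.1 hx.2))

theorem enorm_add_log_le_of_defect_eq_zero {f : ℝ → ℝ} {b x : ℝ} (hx : x ∈ Set.Ioc 0 b)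
    (hfx : defect f x = 0) :
    ‖f x - -Real.log b‖ₑ ≤
      ENNReal.ofReal (Real.log b - Real.log x) + ENNReal.ofReal x * ‖f x⁻¹‖ₑ := by
  have hlog : 0 ≤ Real.log b - Real.log x := sub_nonneg.2 (Real.log_le_log hx.1 hx.2)
  have hfx' : f x - -Real.log b = Real.log b - Real.log x - x * f x⁻¹ := by
    rw [defect] at hfx
    linarith
  rw [hfx', ← Real.enorm_of_nonneg hlog, ← Real.enorm_of_nonneg hx.1.le, ← enorm_mul]
  exact enorm_sub_le

theorem enorm_sub_le_of_defect_eq_zero {f : ℝ → ℝ} {a b x : ℝ} (ha : 0 < a) (hba : b ≤ 2 * a)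
    (hx : x ∈ Set.Icc a b) (hfx : defect f x = 0) (c : ℝ) :
    ‖f x - (-Real.log a - a * c)‖ₑ ≤
      1 + (ENNReal.ofReal a * ‖f x⁻¹ - c‖ₑ + ENNReal.ofReal (b - a) * ‖f x⁻¹‖ₑ) := by
  have hx0 : 0 < x := ha.trans_le hx.1
  have hlog0 : 0 ≤ Real.log x - Real.log a := sub_nonneg.2 (Real.log_le_log ha hx.1)
  have hlog : Real.log x - Real.log a ≤ 1 := by
    rw [← Real.log_div hx0.ne' ha.ne']
    refine (Real.log_le_sub_one_of_pos (by positivity)).trans ?_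
    rw [sub_le_iff_le_add, div_le_iff₀ ha]
    linarith [hx.2]
  have hfx' : f x - (-Real.log a - a * c) =
      -(Real.log x - Real.log a + (a * (f x⁻¹ - c) + (x - a) * f x⁻¹)) := by
    rw [defect] at hfx
    linarith
  rw [hfx', enorm_neg]
  refine (enorm_add_le _ _).trans (add_le_add ?_ ((enorm_add_le _ _).trans ?_))
  · rwa [Real.enorm_of_nonneg hlog0, ENNReal.ofReal_le_one]
  · rw [enorm_mul, enorm_mul, Real.enorm_of_nonneg ha.le,
      Real.enorm_of_nonneg (sub_nonneg.2 hx.1)]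
    gcongr
    exact hx.2

namespace IsWiltonSolution

variable {f : ℝ → ℝ} {a b : ℝ} {M : ℝ≥0∞}

theorem periodic_enorm (hf : IsWiltonSolution f) : Function.Periodic (fun x => ‖f x‖ₑ) 1 :=
  (hf.comp fun y => ‖y‖ₑ).periodic

theorem setLIntegral_enorm_add_log_le (hf : IsWiltonSolution f) (hb0 : 0 < b) (hb : b ≤ 1 / 2) :
    ∫⁻ x in Set.Icc 0 b, ‖f x - -Real.log b‖ₑ ≤ ENNReal.ofReal b * periodMass f := by
  have hb' : 2 ≤ b⁻¹ := by rw [le_inv_comm₀ two_pos hb0]; linarith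
  have hcoef : (2 * (b⁻¹ - 1 / 2) ^ 2)⁻¹ ≤ b :=
    inv_le_of_inv_le₀ hb0 (by nlinarith)
  calc ∫⁻ x in Set.Icc 0 b, ‖f x - -Real.log b‖ₑ
      ≤ ∫⁻ x in Set.Ioc 0 b,
          (ENNReal.ofReal (Real.log b - Real.log x) + ENNReal.ofReal x * ‖f x⁻¹‖ₑ) := by
        rw [setLIntegral_congr Ioc_ae_eq_Icc.symm]
        refine setLIntegral_mono_ae' measurableSet_Ioc (hf.defect_eq_zero.mono fun x hfx hx => ?_)
        exact enorm_add_log_le_of_defect_eq_zero hx (hfx ⟨hx.1, hx.2.trans hb⟩)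
    _ = ENNReal.ofReal b + ∫⁻ x in Set.Ioc 0 b, ENNReal.ofReal x * ‖f x⁻¹‖ₑ := by
        rw [lintegral_add_left (Real.measurable_log.const_sub _).ennreal_ofReal,
          setLIntegral_log_sub_log hb0]
    _ ≤ ENNReal.ofReal b + ENNReal.ofReal b * ∫⁻ x in Set.Ioc (0 : ℝ) 1, ‖f x‖ₑ := by
        gcongr
        refine (setLIntegral_mul_comp_inv_le hf.periodic_enorm hb0 (by linarith)).trans ?_
        gcongr
    _ = _ := by rw [periodMass, mul_add, mul_one]

theorem meanOscLE_near_zero (hf : IsWiltonSolution f) (hab : -b ≤ a) (hb0 : 0 < b)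
    (hb : b ≤ 1 / 2) (hlen : b ≤ 2 * (b - a)) : MeanOscLE f a b (4 * periodMass f) := by
  refine ⟨-Real.log b, ?_⟩
  have hhalf := hf.setLIntegral_enorm_add_log_le hb0 hb
  have hrefl := (hf.comp fun y => ‖y - -Real.log b‖ₑ).setLIntegral_intCast_sub 0 b 0
  rw [Int.cast_zero, zero_sub, sub_zero] at hrefl
  have hcover : Set.Icc a b ⊆ Set.Icc (-b) 0 ∪ Set.Icc 0 b := by
    rw [Set.Icc_union_Icc_eq_Icc (by linarith) hb0.le]
    exact Set.Icc_subset_Icc_left hab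
  calc ∫⁻ x in Set.Icc a b, ‖f x - -Real.log b‖ₑ
      ≤ ENNReal.ofReal b * periodMass f + ENNReal.ofReal b * periodMass f :=
        (lintegral_mono_set hcover).trans ((lintegral_union_le _ _ _).trans
          (by rw [hrefl]; gcongr))
    _ ≤ 2 * (ENNReal.ofReal (2 * (b - a)) * periodMass f) := by
        rw [← two_mul]
        gcongr
    _ = 4 * periodMass f * ENNReal.ofReal (b - a) := by
        rw [ENNReal.ofReal_mul two_pos.le, ENNReal.ofReal_ofNat]
        ring

theorem setLIntegral_comp_inv_oscillation_le (hf : IsWiltonSolution f) (ha : 0 < a) (hab : a < b)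
    (hb : b ≤ 1 / 2) (hba : b ≤ 2 * a) {c : ℝ}
    (hc : ∫⁻ y in Set.Icc b⁻¹ a⁻¹, ‖f y - c‖ₑ ≤ 2 * M * ENNReal.ofReal (a⁻¹ - b⁻¹)) :
    ∫⁻ x in Set.Icc a b, (ENNReal.ofReal a * ‖f x⁻¹ - c‖ₑ + ENNReal.ofReal (b - a) * ‖f x⁻¹‖ₑ) ≤
      (M + ∫⁻ x in Set.Ioc (0 : ℝ) 1, ‖f x‖ₑ) * ENNReal.ofReal (b - a) := by
  have hb0 : 0 < b := ha.trans hab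
  have hosc : b ^ 2 * (a * (2 * (a⁻¹ - b⁻¹))) ≤ b - a := by
    have : b ^ 2 * (a * (2 * (a⁻¹ - b⁻¹))) = 2 * b * (b - a) := by field_simp
    nlinarith
  have hmass : b ^ 2 * (a⁻¹ - b⁻¹ + 1) ≤ 1 := by
    have : b * a⁻¹ ≤ 2 := by rwa [← div_eq_mul_inv, div_le_iff₀ ha]
    have : b ^ 2 * (a⁻¹ - b⁻¹ + 1) = b * (b * a⁻¹) - b + b ^ 2 := by field_simp
    nlinarith
  have hmeas : AEMeasurable (fun y => ENNReal.ofReal a * ‖f y - c‖ₑ)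
      (volume.restrict (Set.Icc b⁻¹ a⁻¹)) :=
    ((hf.aemeasurable.sub_const c).enorm.const_mul _).restrict
  set I := ∫⁻ x in Set.Ioc (0 : ℝ) 1, ‖f x‖ₑ
  calc _ ≤ ENNReal.ofReal (b ^ 2) * ∫⁻ y in Set.Icc b⁻¹ a⁻¹,
          (ENNReal.ofReal a * ‖f y - c‖ₑ + ENNReal.ofReal (b - a) * ‖f y‖ₑ) :=
        setLIntegral_Icc_comp_inv_le ha hab.le
          fun y => ENNReal.ofReal a * ‖f y - c‖ₑ + ENNReal.ofReal (b - a) * ‖f y‖ₑ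
    _ ≤ ENNReal.ofReal (b ^ 2) * (ENNReal.ofReal a * (2 * M * ENNReal.ofReal (a⁻¹ - b⁻¹)) +
          ENNReal.ofReal (b - a) * (ENNReal.ofReal (a⁻¹ - b⁻¹ + 1) * I)) := by
        rw [lintegral_add_left' hmeas, lintegral_const_mul' _ _ ENNReal.ofReal_ne_top,
          lintegral_const_mul' _ _ ENNReal.ofReal_ne_top]
        gcongr
        exact setLIntegral_Icc_le hf.periodic_enorm (inv_anti₀ ha hab.le)
    _ = M * ENNReal.ofReal (b ^ 2 * (a * (2 * (a⁻¹ - b⁻¹)))) +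
          ENNReal.ofReal (b ^ 2 * (a⁻¹ - b⁻¹ + 1)) * I * ENNReal.ofReal (b - a) := by
        rw [ENNReal.ofReal_mul (sq_nonneg b), ENNReal.ofReal_mul (sq_nonneg b),
          ENNReal.ofReal_mul ha.le, ENNReal.ofReal_mul two_pos.le, ENNReal.ofReal_ofNat]
        ring
    _ ≤ M * ENNReal.ofReal (b - a) + 1 * I * ENNReal.ofReal (b - a) := by
        gcongr
        exact ENNReal.ofReal_le_one.2 hmass
    _ = _ := by ring

theorem meanOscLE_of_inv (hf : IsWiltonSolution f) (ha : 0 < a) (hab : a < b) (hb : b ≤ 1 / 2)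
    (hba : b ≤ 2 * a) (hosc : MeanOscLE f b⁻¹ a⁻¹ (2 * M)) :
    MeanOscLE f a b (M + periodMass f) := by
  obtain ⟨c, hc⟩ := hosc
  refine ⟨-Real.log a - a * c, ?_⟩
  calc ∫⁻ x in Set.Icc a b, ‖f x - (-Real.log a - a * c)‖ₑ
      ≤ ∫⁻ x in Set.Icc a b,
          (1 + (ENNReal.ofReal a * ‖f x⁻¹ - c‖ₑ + ENNReal.ofReal (b - a) * ‖f x⁻¹‖ₑ)) := by
        refine setLIntegral_mono_ae' measurableSet_Icc (hf.defect_eq_zero.mono fun x hfx hx => ?_)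
        exact enorm_sub_le_of_defect_eq_zero ha hba hx
          (hfx ⟨ha.trans_le hx.1, hx.2.trans hb⟩) c
    _ = ENNReal.ofReal (b - a) + ∫⁻ x in Set.Icc a b,
          (ENNReal.ofReal a * ‖f x⁻¹ - c‖ₑ + ENNReal.ofReal (b - a) * ‖f x⁻¹‖ₑ) := by
        rw [lintegral_add_left measurable_const, setLIntegral_const, Real.volume_Icc, one_mul]
    _ ≤ ENNReal.ofReal (b - a) +
          (M + ∫⁻ x in Set.Ioc (0 : ℝ) 1, ‖f x‖ₑ) * ENNReal.ofReal (b - a) := by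
        gcongr
        exact hf.setLIntegral_comp_inv_oscillation_le ha hab hb hba hc
    _ = _ := by
        rw [periodMass]
        ring

theorem meanOscLE_across_half (hf : IsWiltonSolution f) (ha : 2 / 5 ≤ a) (ha' : a < 1 / 2)
    (hmid : a + b ≤ 1) (hb : 1 / 2 < b) : MeanOscLE f a b (6 * periodMass f) := by
  have ha0 : 0 < a := by linarith
  have hosc : MeanOscLE f (1 / 2 : ℝ)⁻¹ a⁻¹ (2 * (2 * periodMass f)) := by
    have h2 : 2 < a⁻¹ := by rw [lt_inv_comm₀ two_pos ha0]; linarith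
    have h3 : a⁻¹ ≤ 5 / 2 := by rw [inv_le_comm₀ ha0 (by norm_num)]; linarith
    rw [one_div, inv_inv, ← hf.meanOscLE_sub_intCast 2, Int.cast_ofNat, sub_self, ← mul_assoc,
      show (2 : ℝ≥0∞) * 2 = 4 by norm_num]
    exact hf.meanOscLE_near_zero (by linarith) (by linarith) (by linarith) (by linarith)
  obtain ⟨c, hc⟩ := hf.meanOscLE_of_inv ha0 ha' le_rfl (by linarith) hosc
  refine ⟨c, ?_⟩
  have hrefl := (hf.comp fun y => ‖y - c‖ₑ).setLIntegral_intCast_sub a (1 / 2) 1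
  have hcover : Set.Icc a b ⊆ Set.Icc a (1 / 2) ∪ Set.Icc ((1 : ℤ) - 1 / 2) ((1 : ℤ) - a) := by
    rw [Int.cast_one, sub_half, Set.Icc_union_Icc_eq_Icc ha'.le (by linarith)]
    exact Set.Icc_subset_Icc_right (by linarith)
  calc ∫⁻ x in Set.Icc a b, ‖f x - c‖ₑ
      ≤ (2 * periodMass f + periodMass f) * ENNReal.ofReal (1 / 2 - a) +
          (2 * periodMass f + periodMass f) * ENNReal.ofReal (1 / 2 - a) :=
        (lintegral_mono_set hcover).trans ((lintegral_union_le _ _ _).trans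
          (by rw [hrefl]; gcongr))
    _ = 6 * periodMass f * ENNReal.ofReal (1 / 2 - a) := by ring
    _ ≤ _ := by gcongr

theorem meanOscLE_of_long (hf : IsWiltonSolution f) (hlen : 1 / 10 < b - a) :
    MeanOscLE f a b (11 * periodMass f) := by
  refine ⟨0, ?_⟩
  simp only [sub_zero]
  calc ∫⁻ x in Set.Icc a b, ‖f x‖ₑ
      ≤ ENNReal.ofReal (b - a + 1) * ∫⁻ x in Set.Ioc (0 : ℝ) 1, ‖f x‖ₑ :=
        setLIntegral_Icc_le hf.periodic_enorm (by linarith)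
    _ ≤ ENNReal.ofReal (11 * (b - a)) * periodMass f := by
        gcongr
        · linarith
        · exact le_add_self
    _ = _ := by
        rw [ENNReal.ofReal_mul (by norm_num), ENNReal.ofReal_ofNat]
        ring

/-- The inversion `x ↦ x⁻¹` multiplies the length of an interval in `(0, 1/2]` by at least `4`, so
finitely many applications of `meanOscLE_of_inv` lead to one of the three base cases. -/
theorem meanOscLE (hf : IsWiltonSolution f) (hab : a < b) :
    MeanOscLE f a b (11 * periodMass f) := by
  obtain ⟨n, hn⟩ : ∃ n : ℕ, 1 / 10 < 4 ^ n * (b - a) := by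
    obtain ⟨n, hn⟩ := pow_unbounded_of_one_lt (1 / 10 / (b - a)) (by norm_num : (1 : ℝ) < 4)
    exact ⟨n, (div_lt_iff₀ (sub_pos.2 hab)).1 hn⟩
  induction n generalizing a b with
  | zero => exact hf.meanOscLE_of_long (by simpa only [pow_zero, one_mul] using hn)
  | succ n ih =>
    refine hf.meanOscLE_of_midpoint fun a' b' hlen h0 h1 => ?_
    rw [← hlen] at hn
    replace hab : a' < b' := by linarith
    rcases lt_or_ge (1 / 10) (b' - a') with hlong | hshort
    · exact hf.meanOscLE_of_long hlong
    rcases lt_or_ge (2 * a') b' with hnear | hfar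
    · exact (hf.meanOscLE_near_zero (by linarith) (by linarith) (by linarith)
        (by linarith)).mono (by gcongr; norm_num)
    rcases lt_or_ge (1 / 2) b' with hb | hb
    · exact (hf.meanOscLE_across_half (by linarith) (by linarith) h1 hb).mono
        (by gcongr; norm_num)
    have ha : 0 < a' := by linarith
    have hexpand : 4 * (b' - a') ≤ a'⁻¹ - b'⁻¹ := by
      have : a' * b' ≤ 1 / 4 := by nlinarith
      rw [inv_sub_inv ha.ne' (by linarith), le_div_iff₀ (mul_pos ha (by linarith))]
      nlinarith
    have hosc : MeanOscLE f b'⁻¹ a'⁻¹ (2 * (10 * periodMass f)) :=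
      (ih (inv_strictAnti₀ ha hab) (hn.trans_le (by rw [pow_succ, mul_assoc]; gcongr))).mono
        (by rw [← mul_assoc]; gcongr; norm_num)
    convert hf.meanOscLE_of_inv ha hab hb hfar hosc using 1
    ring

end IsWiltonSolution

/-! ### The distance to the nearest integer -/

/-- The distance from `x` to the nearest integer. -/
def nearDist (x : ℝ) : ℝ := |x - round x|

theorem nearDist_eq_min (x : ℝ) : nearDist x = min (Int.fract x) (1 - Int.fract x) :=
  abs_sub_round_eq_min x

theorem nearDist_le_self {x : ℝ} (hx : 0 ≤ x) : nearDist x ≤ x := by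
  simpa only [nearDist, Int.cast_zero, sub_zero, abs_of_nonneg hx] using round_le x 0

theorem nearDist_pos {x : ℝ} (hx : Irrational x) : 0 < nearDist x :=
  abs_pos.2 (sub_ne_zero.2 (hx.ne_int _))

theorem fract_neg_eq_or (x : ℝ) :
    Int.fract (-x) = 1 - Int.fract x ∨ Int.fract (-x) = 0 ∧ Int.fract x = 0 := by
  by_cases h : Int.fract x = 0
  · exact Or.inr ⟨Int.fract_neg_eq_zero.2 h, h⟩
  · exact Or.inl (Int.fract_neg h)

theorem evenPeriodic_of_fract {β : Type*} {k : ℝ → β} (hk : ∀ t, k (1 - t) = k t) :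
    EvenPeriodic fun x => k (Int.fract x) where
  periodic x := congrArg k (Int.fract_add_one x)
  even x := by
    rcases fract_neg_eq_or x with h | ⟨h, h'⟩
    · simp only [h, hk]
    · simp only [h, h']

theorem evenPeriodic_nearDist : EvenPeriodic nearDist := by
  rw [funext nearDist_eq_min]
  exact evenPeriodic_of_fract (k := fun t => min t (1 - t)) fun t => by
    rw [sub_sub_cancel, min_comm]

theorem measurable_nearDist : Measurable nearDist := by
  rw [funext nearDist_eq_min]
  exact measurable_fract.min (measurable_const.sub measurable_fract)

/-- The logarithmic singularity at the integers, `log (1 / nearDist x)`. -/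
def logDist (x : ℝ) : ℝ := -Real.log (nearDist x)

theorem evenPeriodic_logDist : EvenPeriodic logDist :=
  evenPeriodic_nearDist.comp fun d => -Real.log d

theorem measurable_logDist : Measurable logDist := measurable_nearDist.log.neg

theorem neg_log_le_logDist {x : ℝ} (hx : Irrational x) (hx0 : 0 ≤ x) :
    -Real.log x ≤ logDist x :=
  neg_le_neg (Real.log_le_log (nearDist_pos hx) (nearDist_le_self hx0))

theorem setLIntegral_logDist_ne_top :
    ∫⁻ x in Set.Ioc (0 : ℝ) 1, ENNReal.ofReal (logDist x) ≠ ∞ := by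
  have h1 : IntegrableOn (fun x => -Real.log x) (Set.Ioc (0 : ℝ) 1) :=
    ((intervalIntegrable_iff_integrableOn_Ioc_of_le zero_le_one).1
      intervalIntegral.intervalIntegrable_log').neg
  have h2 : IntegrableOn (fun x => -Real.log (1 - x)) (Set.Ioc (0 : ℝ) 1) := by
    have := (intervalIntegral.intervalIntegrable_log' (a := 1) (b := 0)).comp_sub_left 1
    simp only [sub_self, sub_zero] at this
    exact ((intervalIntegrable_iff_integrableOn_Ioc_of_le zero_le_one).1 this).neg
  refine ne_top_of_le_ne_top (h1.add h2).lintegral_lt_top.ne ?_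
  rw [setLIntegral_congr Ioo_ae_eq_Ioc.symm, setLIntegral_congr Ioo_ae_eq_Ioc.symm]
  refine setLIntegral_mono' measurableSet_Ioo fun x hx => ENNReal.ofReal_le_ofReal ?_
  have ha : Real.log x ≤ 0 := Real.log_nonpos hx.1.le hx.2.le
  have hb : Real.log (1 - x) ≤ 0 := Real.log_nonpos (by linarith [hx.2]) (by linarith [hx.1])
  rw [logDist, nearDist_eq_min, Int.fract_eq_self.2 ⟨hx.1.le, hx.2⟩, Pi.add_apply]
  rcases min_choice x (1 - x) with h | h <;> rw [h] <;> linarith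

/-! ### The weight -/

section Transfer

variable {f : ℝ → ℝ≥0∞}

/-- The function `t ↦ (10/9) t f(1/t)` cut off to `(0, g]`. -/
def cutTransfer (f : ℝ → ℝ≥0∞) : ℝ → ℝ≥0∞ :=
  Set.indicator (Set.Ioc 0 g) fun t => ENNReal.ofReal (10 / 9 * t) * f t⁻¹

/-- A positive operator on even periodic functions that dominates all the operators
`f ↦ (10/9) x f(A_α x)`, `α ∈ [1 - g, g]`. The factor `10/9` still leaves it a contraction
in `L¹` and is what makes terms decay geometrically along the orbits. -/
def transfer (f : ℝ → ℝ≥0∞) (x : ℝ) : ℝ≥0∞ :=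
  cutTransfer f (Int.fract x) + cutTransfer f (1 - Int.fract x)

theorem le_transfer (f : ℝ → ℝ≥0∞) {x : ℝ} (h0 : 0 < x) (h1 : x ≤ g) :
    ENNReal.ofReal (10 / 9 * x) * f x⁻¹ ≤ transfer f x := by
  have hmem : x ∈ Set.Ioc 0 g := ⟨h0, h1⟩
  rw [transfer, Int.fract_eq_self.2 ⟨h0.le, by linarith [g_lt_two_thirds]⟩, cutTransfer,
    Set.indicator_of_mem hmem]
  exact le_self_add

theorem evenPeriodic_transfer (f : ℝ → ℝ≥0∞) : EvenPeriodic (transfer f) :=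
  evenPeriodic_of_fract (k := fun t => cutTransfer f t + cutTransfer f (1 - t)) fun t => by
    rw [sub_sub_cancel, add_comm]

theorem measurable_cutTransfer (hf : Measurable f) : Measurable (cutTransfer f) :=
  ((ENNReal.measurable_ofReal.comp (measurable_id.const_mul _)).mul
    (hf.comp measurable_inv)).indicator measurableSet_Ioc

theorem measurable_transfer (hf : Measurable f) : Measurable (transfer f) :=
  ((measurable_cutTransfer hf).comp measurable_fract).add
    ((measurable_cutTransfer hf).comp (measurable_const.sub measurable_fract))

theorem transfer_tsum (F : ℕ → ℝ → ℝ≥0∞) (x : ℝ) :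
    transfer (fun y => ∑' j, F j y) x = ∑' j, transfer (F j) x := by
  have h (t : ℝ) : cutTransfer (fun y => ∑' j, F j y) t = ∑' j, cutTransfer (F j) t := by
    unfold cutTransfer
    by_cases ht : t ∈ Set.Ioc 0 g
    · simp only [Set.indicator_of_mem ht, ENNReal.tsum_mul_left]
    · simp only [Set.indicator_of_notMem ht, tsum_zero]
  simp only [transfer, h, ENNReal.tsum_add]

theorem lintegral_cutTransfer_le (hf : Function.Periodic f 1) :
    ∫⁻ x, cutTransfer f x ≤ ENNReal.ofReal (4 / 9) * ∫⁻ x in Set.Ioc (0 : ℝ) 1, f x := by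
  have hg : (2 * (g⁻¹ - 1 / 2) ^ 2)⁻¹ = 2 / 5 := by
    rw [inv_g, show 2 * (1 + g - 1 / 2) ^ 2 = 5 / 2 by linear_combination 2 * g_sq]
    norm_num
  have hmul := setLIntegral_mul_comp_inv_le hf g_pos (by linarith [g_lt_two_thirds])
  rw [hg] at hmul
  rw [show (4 / 9 : ℝ) = 10 / 9 * (2 / 5) by norm_num, ENNReal.ofReal_mul (by norm_num), mul_assoc,
    cutTransfer.eq_def, lintegral_indicator measurableSet_Ioc]
  simp only [ENNReal.ofReal_mul (show (0 : ℝ) ≤ 10 / 9 by norm_num), mul_assoc]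
  rw [lintegral_const_mul' _ _ ENNReal.ofReal_ne_top]
  gcongr

theorem setLIntegral_transfer_le (hf : Function.Periodic f 1) (hm : Measurable f) :
    ∫⁻ x in Set.Ioc (0 : ℝ) 1, transfer f x ≤
      ENNReal.ofReal (8 / 9) * ∫⁻ x in Set.Ioc (0 : ℝ) 1, f x :=
  calc ∫⁻ x in Set.Ioc (0 : ℝ) 1, transfer f x
      = ∫⁻ x in Set.Ioo (0 : ℝ) 1, (cutTransfer f x + cutTransfer f (1 - x)) := by
        rw [setLIntegral_congr Ioo_ae_eq_Ioc.symm]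
        refine setLIntegral_congr_fun measurableSet_Ioo fun x hx => ?_
        simp only [transfer, Int.fract_eq_self.2 ⟨hx.1.le, hx.2⟩]
    _ ≤ ∫⁻ x, (cutTransfer f x + cutTransfer f (1 - x)) := setLIntegral_le_lintegral _ _
    _ = 2 * ∫⁻ x, cutTransfer f x := by
        rw [lintegral_add_left (measurable_cutTransfer hm),
          lintegral_sub_left_eq_self (cutTransfer f) 1, two_mul]
    _ ≤ 2 * (ENNReal.ofReal (4 / 9) * ∫⁻ x in Set.Ioc (0 : ℝ) 1, f x) := by
        gcongr
        exact lintegral_cutTransfer_le hf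
    _ = _ := by
        rw [← mul_assoc, ← ENNReal.ofReal_ofNat, ← ENNReal.ofReal_mul (by norm_num)]
        norm_num

theorem evenPeriodic_iterate_transfer (hf : EvenPeriodic f) :
    ∀ j, EvenPeriodic (transfer^[j] f)
  | 0 => hf
  | j + 1 => by
    rw [Function.iterate_succ_apply']
    exact evenPeriodic_transfer _

theorem measurable_iterate_transfer (hf : Measurable f) (j : ℕ) :
    Measurable (transfer^[j] f) :=
  Function.Iterate.rec _ hf (fun _ => measurable_transfer) j

theorem setLIntegral_iterate_transfer_le (hf : EvenPeriodic f) (hm : Measurable f) (j : ℕ) :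
    ∫⁻ x in Set.Ioc (0 : ℝ) 1, (transfer^[j] f) x ≤
      ENNReal.ofReal (8 / 9) ^ j * ∫⁻ x in Set.Ioc (0 : ℝ) 1, f x := by
  induction j with
  | zero => rw [Function.iterate_zero_apply, pow_zero, one_mul]
  | succ j ih =>
    rw [Function.iterate_succ_apply', pow_succ', mul_assoc]
    refine (setLIntegral_transfer_le (evenPeriodic_iterate_transfer hf j).periodic
      (measurable_iterate_transfer hm j)).trans ?_
    gcongr

end Transfer

/-- The Lyapunov function of the folded continued fraction maps: the Neumann series of `transfer`
applied to `logDist`. -/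
def weight (x : ℝ) : ℝ≥0∞ := ∑' j, (transfer^[j] fun y => ENNReal.ofReal (logDist y)) x

theorem evenPeriodic_weight : EvenPeriodic weight := by
  have h := evenPeriodic_iterate_transfer (evenPeriodic_logDist.comp ENNReal.ofReal)
  exact ⟨fun x => tsum_congr fun j => (h j).periodic x, fun x => tsum_congr fun j => (h j).even x⟩

theorem measurable_weight : Measurable weight :=
  Measurable.tsum (measurable_iterate_transfer measurable_logDist.ennreal_ofReal)

theorem ofReal_logDist_le_weight (x : ℝ) : ENNReal.ofReal (logDist x) ≤ weight x :=
  ENNReal.le_tsum (f := fun j => (transfer^[j] fun y => ENNReal.ofReal (logDist y)) x) 0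

theorem transfer_weight_le (x : ℝ) : transfer weight x ≤ weight x := by
  refine (transfer_tsum _ x).trans_le ?_
  simp only [← Function.iterate_succ_apply' transfer]
  exact ENNReal.tsum_comp_le_tsum_of_injective (add_left_injective 1)
    fun j => (transfer^[j] fun y => ENNReal.ofReal (logDist y)) x

theorem ofReal_mul_weight_inv_le {x : ℝ} (h0 : 0 < x) (h1 : x ≤ g) :
    ENNReal.ofReal (10 / 9 * x) * weight x⁻¹ ≤ weight x :=
  (le_transfer weight h0 h1).trans (transfer_weight_le x)

theorem setLIntegral_weight_ne_top : ∫⁻ x in Set.Ioc (0 : ℝ) 1, weight x ≠ ∞ := by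
  have hm : Measurable fun y => ENNReal.ofReal (logDist y) := measurable_logDist.ennreal_ofReal
  unfold weight
  rw [lintegral_tsum fun j => (measurable_iterate_transfer hm j).aemeasurable]
  refine ne_top_of_le_ne_top ?_ (ENNReal.tsum_le_tsum
    (setLIntegral_iterate_transfer_le (evenPeriodic_logDist.comp ENNReal.ofReal) hm))
  rw [ENNReal.tsum_mul_right, ENNReal.tsum_geometric]
  have hlt : ENNReal.ofReal (8 / 9) < 1 := ENNReal.ofReal_lt_one.2 (by norm_num)
  exact ENNReal.mul_ne_top (ENNReal.inv_ne_top.2 (tsub_pos_of_lt hlt).ne')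
    setLIntegral_logDist_ne_top

/-- An irrational point at which the weight is finite. Almost every point is regular, and at a
regular point all the series `W_α` with `α ∈ [1 - g, g]` converge absolutely. -/
structure Regular (x : ℝ) : Prop where
  irrational : Irrational x
  weight_ne_top : weight x ≠ ∞

namespace Regular

variable {x : ℝ}

theorem sub_intCast (hx : Regular x) (n : ℤ) : Regular (x - n) :=
  ⟨hx.irrational.sub_intCast n, by rw [evenPeriodic_weight.sub_intCast]; exact hx.weight_ne_top⟩

theorem neg (hx : Regular x) : Regular (-x) :=
  ⟨hx.irrational.neg, by rw [evenPeriodic_weight.even]; exact hx.weight_ne_top⟩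

theorem intCast_sub (hx : Regular x) (n : ℤ) : Regular (n - x) := by
  rw [← neg_sub]
  exact (hx.sub_intCast n).neg

theorem abs_sub_intCast (hx : Regular x) (n : ℤ) : Regular |x - n| := by
  rcases abs_choice (x - n) with h | h <;> rw [h]
  · exact hx.sub_intCast n
  · exact (hx.sub_intCast n).neg

theorem inv_of_le (hx : Regular x) (h0 : 0 < x) (h1 : x ≤ g) : Regular x⁻¹ where
  irrational := hx.irrational.inv
  weight_ne_top htop := by
    have h := ofReal_mul_weight_inv_le h0 h1
    rw [htop, ENNReal.mul_top (ENNReal.ofReal_pos.2 (by positivity)).ne', top_le_iff] at h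
    exact hx.weight_ne_top h

theorem mul_toReal_weight_inv_le (hx : Regular x) (h0 : 0 < x) (h1 : x ≤ g) :
    x * (weight x⁻¹).toReal ≤ 9 / 10 * (weight x).toReal := by
  have h := ENNReal.toReal_mono hx.weight_ne_top (ofReal_mul_weight_inv_le h0 h1)
  rw [ENNReal.toReal_mul, ENNReal.toReal_ofReal (by positivity)] at h
  linarith

theorem neg_log_le_toReal_weight (hx : Regular x) (h0 : 0 ≤ x) :
    -Real.log x ≤ (weight x).toReal :=
  (neg_log_le_logDist hx.irrational h0).trans
    ((ENNReal.ofReal_le_iff_le_toReal hx.weight_ne_top).1 (ofReal_logDist_le_weight x))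

end Regular

theorem ae_regular : ∀ᵐ x : ℝ, Regular x := by
  have hfin : ∀ᵐ x : ℝ, ∀ n : ℤ, x ∈ Set.Icc (n : ℝ) (n + 1) → weight x < ∞ := by
    refine ae_all_iff.2 fun n => (ae_restrict_iff' measurableSet_Icc).1 ?_
    refine ae_lt_top measurable_weight ?_
    rw [setLIntegral_Icc_add_one evenPeriodic_weight.periodic]
    exact setLIntegral_weight_ne_top
  have hirr : ∀ᵐ x : ℝ, Irrational x := (Set.countable_range ((↑) : ℚ → ℝ)).ae_notMem volume
  filter_upwards [hfin, hirr] with x hx hx'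
  exact ⟨hx', (hx ⌊x⌋ ⟨Int.floor_le x, (Int.lt_floor_add_one x).le⟩).ne⟩

/-- The regular points of `(0, g]`, a set containing the orbits of all regular points under all
maps `A_α` with `α ∈ [1 - g, g]`. -/
def regularSet : Set ℝ := {x | Regular x} ∩ Set.Ioc 0 g

theorem abs_sub_intCast_mem_regularSet {x : ℝ} {n : ℤ} (hx : Regular x) (h : |x - n| ≤ g) :
    |x - n| ∈ regularSet :=
  ⟨hx.abs_sub_intCast n, abs_pos.2 (sub_ne_zero.2 (hx.irrational.ne_int n)), h⟩

/-! ### Orbits and convergence of the series -/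

section Orbits

variable {α x : ℝ}

theorem abs_sub_floor_le (hα : α ∈ Set.Icc (1 - g) g) (x : ℝ) : |x - ⌊x + 1 - α⌋| ≤ g := by
  have h1 := Int.floor_le (x + 1 - α)
  have h2 := Int.lt_floor_add_one (x + 1 - α)
  rw [abs_le]
  constructor <;> linarith [hα.1, hα.2]

theorem nakadaMap_of_ne_zero (α : ℝ) (hx : x ≠ 0) :
    nakadaMap α x = |x⁻¹ - (⌊x⁻¹ + 1 - α⌋ : ℝ)| := by
  rw [nakadaMap, if_neg hx, one_div]

theorem EvenPeriodic.apply_startPoint {β : Type*} {f : ℝ → β} (hf : EvenPeriodic f) :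
    f (startPoint α x) = f x :=
  hf.abs_sub_intCast x _

theorem EvenPeriodic.apply_nakadaMap {β : Type*} {f : ℝ → β} (hf : EvenPeriodic f) (hx : x ≠ 0) :
    f (nakadaMap α x) = f x⁻¹ := by
  rw [nakadaMap_of_ne_zero α hx, hf.abs_sub_intCast]

theorem startPoint_mem_regularSet (hα : α ∈ Set.Icc (1 - g) g) (hx : Regular x) :
    startPoint α x ∈ regularSet :=
  have hmax : max α (1 - α) ∈ Set.Icc (1 - g) g :=
    ⟨hα.1.trans (le_max_left _ _), max_le hα.2 (by linarith [hα.1])⟩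
  abs_sub_intCast_mem_regularSet hx (abs_sub_floor_le hmax x)

theorem mapsTo_nakadaMap_regularSet (hα : α ∈ Set.Icc (1 - g) g) :
    Set.MapsTo (nakadaMap α) regularSet regularSet := fun x ⟨hx, h0, h1⟩ => by
  rw [nakadaMap_of_ne_zero α h0.ne']
  exact abs_sub_intCast_mem_regularSet (hx.inv_of_le h0 h1) (abs_sub_floor_le hα _)

theorem orbitPoint_succ (α x : ℝ) (j : ℕ) :
    orbitPoint α x (j + 1) = nakadaMap α (orbitPoint α x j) :=
  Function.iterate_succ_apply' _ _ _

theorem betaPrev_succ (α x : ℝ) (j : ℕ) :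
    betaPrev α x (j + 1) = betaPrev α x j * orbitPoint α x j :=
  Finset.prod_range_succ _ _

theorem hasSum_pow_mul (c : ℝ) : HasSum (fun j : ℕ => (9 / 10) ^ j * c) (10 * c) := by
  have h := hasSum_geometric_of_lt_one (show (0 : ℝ) ≤ 9 / 10 by norm_num) (by norm_num)
  simpa only [show (1 - 9 / 10 : ℝ)⁻¹ = 10 by norm_num] using h.mul_right c

namespace Regular

theorem orbitPoint_mem (hx : Regular x) (hα : α ∈ Set.Icc (1 - g) g) (j : ℕ) :
    orbitPoint α x j ∈ regularSet :=
  (mapsTo_nakadaMap_regularSet hα).iterate j (startPoint_mem_regularSet hα hx)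

theorem betaPrev_nonneg (hx : Regular x) (hα : α ∈ Set.Icc (1 - g) g) (j : ℕ) :
    0 ≤ betaPrev α x j :=
  Finset.prod_nonneg fun i _ => (hx.orbitPoint_mem hα i).2.1.le

theorem betaPrev_le (hx : Regular x) (hα : α ∈ Set.Icc (1 - g) g) (j : ℕ) :
    betaPrev α x j ≤ g ^ j :=
  (Finset.prod_le_prod (fun i _ => (hx.orbitPoint_mem hα i).2.1.le)
    fun i _ => (hx.orbitPoint_mem hα i).2.2).trans_eq
      (by rw [Finset.prod_const, Finset.card_range])

theorem betaPrev_mul_toReal_weight_le (hx : Regular x) (hα : α ∈ Set.Icc (1 - g) g) (j : ℕ) :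
    betaPrev α x j * (weight (orbitPoint α x j)).toReal ≤ (9 / 10) ^ j * (weight x).toReal := by
  induction j with
  | zero =>
    rw [orbitPoint, Function.iterate_zero_apply, evenPeriodic_weight.apply_startPoint, betaPrev,
      Finset.prod_range_zero, pow_zero]
  | succ j ih =>
    obtain ⟨hreg, h0, h1⟩ := hx.orbitPoint_mem hα j
    calc betaPrev α x (j + 1) * (weight (orbitPoint α x (j + 1))).toReal
        = betaPrev α x j * (orbitPoint α x j * (weight (orbitPoint α x j)⁻¹).toReal) := by
          rw [betaPrev_succ, orbitPoint_succ, evenPeriodic_weight.apply_nakadaMap h0.ne', mul_assoc]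
      _ ≤ betaPrev α x j * (9 / 10 * (weight (orbitPoint α x j)).toReal) := by
          exact mul_le_mul_of_nonneg_left (hreg.mul_toReal_weight_inv_le h0 h1)
            (hx.betaPrev_nonneg hα j)
      _ = 9 / 10 * (betaPrev α x j * (weight (orbitPoint α x j)).toReal) := by ring
      _ ≤ 9 / 10 * ((9 / 10) ^ j * (weight x).toReal) := by gcongr
      _ = (9 / 10) ^ (j + 1) * (weight x).toReal := by ring

theorem norm_wiltonTerm_le (hx : Regular x) (hα : α ∈ Set.Icc (1 - g) g) (j : ℕ) :
    ‖wiltonTerm α x j‖ ≤ (9 / 10) ^ j * (weight x).toReal := by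
  obtain ⟨hreg, h0, h1⟩ := hx.orbitPoint_mem hα j
  have hlog : Real.log (orbitPoint α x j) ≤ 0 :=
    Real.log_nonpos h0.le (by linarith [g_lt_two_thirds])
  rw [wiltonTerm, one_div, Real.log_inv, Real.norm_eq_abs, abs_mul, abs_mul, abs_neg_one_pow,
    one_mul, abs_of_nonneg (hx.betaPrev_nonneg hα j), abs_of_nonneg (neg_nonneg.2 hlog)]
  refine le_trans ?_ (hx.betaPrev_mul_toReal_weight_le hα j)
  exact mul_le_mul_of_nonneg_left (hreg.neg_log_le_toReal_weight h0.le) (hx.betaPrev_nonneg hα j)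

theorem summable_wiltonTerm (hx : Regular x) (hα : α ∈ Set.Icc (1 - g) g) :
    Summable (wiltonTerm α x) :=
  Summable.of_norm_bounded (hasSum_pow_mul _).summable (hx.norm_wiltonTerm_le hα)

theorem wiltonFunction_eq_tsum (hx : Regular x) (hα : α ∈ Set.Icc (1 - g) g) :
    wiltonFunction α x = ∑' j, wiltonTerm α x j :=
  (hx.summable_wiltonTerm hα).hasSum.tendsto_sum_nat.limUnder_eq

theorem tendsto_wiltonPartialSum (hx : Regular x) (hα : α ∈ Set.Icc (1 - g) g) :
    Tendsto (fun N => wiltonPartialSum α N x) atTop (𝓝 (wiltonFunction α x)) := by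
  rw [hx.wiltonFunction_eq_tsum hα]
  exact (hx.summable_wiltonTerm hα).hasSum.tendsto_sum_nat

theorem wiltonConverges (hx : Regular x) (hα : α ∈ Set.Icc (1 - g) g) : WiltonConverges α x :=
  ⟨_, hx.tendsto_wiltonPartialSum hα⟩

theorem abs_wiltonFunction_le (hx : Regular x) (hα : α ∈ Set.Icc (1 - g) g) :
    |wiltonFunction α x| ≤ 10 * (weight x).toReal := by
  rw [hx.wiltonFunction_eq_tsum hα]
  exact tsum_of_norm_bounded (hasSum_pow_mul _) (hx.norm_wiltonTerm_le hα)

theorem enorm_wiltonFunction_le (hx : Regular x) (hα : α ∈ Set.Icc (1 - g) g) :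
    ‖wiltonFunction α x‖ₑ ≤ 10 * weight x := by
  rw [Real.enorm_eq_ofReal_abs, ← ENNReal.ofReal_toReal hx.weight_ne_top, ← ENNReal.ofReal_ofNat,
    ← ENNReal.ofReal_mul (by norm_num)]
  exact ENNReal.ofReal_le_ofReal (hx.abs_wiltonFunction_le hα)

end Regular

theorem measurable_nakadaMap (α : ℝ) : Measurable (nakadaMap α) := by
  have hinv : Measurable fun x : ℝ => 1 / x := measurable_id.const_div 1
  have hfloor : Measurable fun x : ℝ => (⌊1 / x + 1 - α⌋ : ℝ) :=
    (measurable_of_countable _).comp ((hinv.add_const 1).sub_const α).floor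
  exact Measurable.ite (measurableSet_singleton 0) measurable_const
    (continuous_abs.measurable.comp (hinv.sub hfloor))

theorem measurable_startPoint (α : ℝ) : Measurable (startPoint α) := by
  have hfloor : Measurable fun x : ℝ => (⌊x + 1 - max α (1 - α)⌋ : ℝ) :=
    (measurable_of_countable _).comp ((measurable_id.add_const 1).sub_const _).floor
  exact continuous_abs.measurable.comp (measurable_id.sub hfloor)

theorem measurable_orbitPoint (α : ℝ) (j : ℕ) : Measurable fun x => orbitPoint α x j :=
  ((measurable_nakadaMap α).iterate j).comp (measurable_startPoint α)

theorem measurable_wiltonPartialSum (α : ℝ) (N : ℕ) : Measurable (wiltonPartialSum α N) :=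
  Finset.measurable_fun_sum _ fun j _ =>
    ((Finset.measurable_fun_prod _ fun i _ => measurable_orbitPoint α i).const_mul _).mul
      (Real.measurable_log.comp ((measurable_orbitPoint α j).const_div 1))

theorem aestronglyMeasurable_wiltonFunction (hα : α ∈ Set.Icc (1 - g) g) :
    AEStronglyMeasurable (wiltonFunction α) volume :=
  aestronglyMeasurable_of_tendsto_ae atTop
    (fun N => (measurable_wiltonPartialSum α N).aestronglyMeasurable)
    (ae_regular.mono fun _ hx => hx.tendsto_wiltonPartialSum hα)

theorem setLIntegral_const_mul_weight_ne_top :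
    ∫⁻ x in Set.Ioc (0 : ℝ) 1, 10 * weight x ≠ ∞ := by
  rw [lintegral_const_mul _ measurable_weight]
  exact ENNReal.mul_ne_top (by norm_num) setLIntegral_weight_ne_top

theorem locallyIntegrable_wiltonFunction (hα : α ∈ Set.Icc (1 - g) g) :
    LocallyIntegrable (wiltonFunction α) volume :=
  locallyIntegrable_of_enorm_le (aestronglyMeasurable_wiltonFunction hα)
    (evenPeriodic_weight.comp fun w => 10 * w).periodic setLIntegral_const_mul_weight_ne_top
    (ae_regular.mono fun _ hx => hx.enorm_wiltonFunction_le hα)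

end Orbits

/-! ### The case `α = 1/2` -/

theorem half_mem_Icc : (1 / 2 : ℝ) ∈ Set.Icc (1 - g) g :=
  ⟨by linarith [half_lt_g], half_lt_g.le⟩

theorem startPoint_half (x : ℝ) : startPoint (1 / 2) x = nearDist x := by
  rw [startPoint, nearDist, round_eq, sub_half, max_self, add_sub_assoc, sub_half]

theorem nakadaMap_half {x : ℝ} (hx : x ≠ 0) :
    nakadaMap (1 / 2) x = startPoint (1 / 2) x⁻¹ := by
  rw [nakadaMap_of_ne_zero _ hx, startPoint, sub_half, max_self]

theorem startPoint_half_of_mem {x : ℝ} (hx : x ∈ Set.Ioc 0 (1 / 2)) :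
    startPoint (1 / 2) x = x := by
  rw [startPoint_half, nearDist_eq_min, Int.fract_eq_self.2 ⟨hx.1.le, by linarith [hx.2]⟩,
    min_eq_left (by linarith [hx.2])]

theorem evenPeriodic_wiltonFunction_half : EvenPeriodic (wiltonFunction (1 / 2)) := by
  have horbit : EvenPeriodic (orbitPoint (1 / 2)) := by
    have heq : orbitPoint (1 / 2) = fun x j => (nakadaMap (1 / 2))^[j] (nearDist x) := by
      ext x j
      rw [orbitPoint, startPoint_half]
    rw [heq]
    exact evenPeriodic_nearDist.comp fun y j => (nakadaMap (1 / 2))^[j] y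
  exact horbit.comp fun o => limUnder atTop fun N => ∑ j ∈ Finset.range N,
    (-1) ^ j * (∏ i ∈ Finset.range j, o i) * Real.log (1 / o j)

theorem wiltonTerm_half_succ {x : ℝ} (hx : x ∈ Set.Ioc 0 (1 / 2)) (j : ℕ) :
    wiltonTerm (1 / 2) x (j + 1) = -x * wiltonTerm (1 / 2) x⁻¹ j := by
  have h0 : orbitPoint (1 / 2) x 0 = x := startPoint_half_of_mem hx
  have hsucc (i : ℕ) : orbitPoint (1 / 2) x (i + 1) = orbitPoint (1 / 2) x⁻¹ i := by
    rw [orbitPoint, startPoint_half_of_mem hx, Function.iterate_succ_apply,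
      nakadaMap_half hx.1.ne', orbitPoint]
  rw [wiltonTerm, wiltonTerm, betaPrev, Finset.prod_range_succ', h0, betaPrev]
  simp only [hsucc]
  ring

theorem Regular.defect_wiltonFunction_half {x : ℝ} (hx : Regular x) (hx' : x ∈ Set.Ioc 0 (1 / 2)) :
    defect (wiltonFunction (1 / 2)) x = 0 := by
  have hinv : Regular x⁻¹ := hx.inv_of_le hx'.1 (hx'.2.trans half_lt_g.le)
  have hzero : wiltonTerm (1 / 2) x 0 = -Real.log x := by
    rw [wiltonTerm, betaPrev, Finset.prod_range_zero, pow_zero, one_mul, one_mul, one_div,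
      Real.log_inv, orbitPoint, Function.iterate_zero_apply, startPoint_half_of_mem hx']
  have heq : wiltonFunction (1 / 2) x = -Real.log x + -x * wiltonFunction (1 / 2) x⁻¹ := by
    rw [hx.wiltonFunction_eq_tsum half_mem_Icc, hinv.wiltonFunction_eq_tsum half_mem_Icc,
      (hx.summable_wiltonTerm half_mem_Icc).tsum_eq_zero_add, hzero, ← tsum_mul_left]
    simp only [wiltonTerm_half_succ hx']
  rw [defect, heq]
  ring

theorem isWiltonSolution_wiltonFunction_half : IsWiltonSolution (wiltonFunction (1 / 2)) where
  toEvenPeriodic := evenPeriodic_wiltonFunction_half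
  aemeasurable := (aestronglyMeasurable_wiltonFunction half_mem_Icc).aemeasurable
  defect_eq_zero := ae_regular.mono fun _ hx hx' => hx.defect_wiltonFunction_half hx'

theorem periodMass_wiltonFunction_half_ne_top : periodMass (wiltonFunction (1 / 2)) ≠ ∞ := by
  refine ENNReal.add_ne_top.2 ⟨ENNReal.one_ne_top, ?_⟩
  exact ne_top_of_le_ne_top setLIntegral_const_mul_weight_ne_top (lintegral_mono_ae
    (ae_restrict_of_ae (ae_regular.mono fun _ hx => hx.enorm_wiltonFunction_le half_mem_Icc)))

/-! ### The defect of `W_{1/2}` on `(1/2, g]` -/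

/-- The inhomogeneous term of the recursion `EvenPeriodic.defect_eq`. -/
def defectSource (x : ℝ) : ℝ :=
  (1 + x) * Real.log x - (1 + (1 - x)) * Real.log (1 - x) - (2 * x - 1) * Real.log (2 * x - 1)

theorem mul_log_mem_Icc {t : ℝ} (h0 : 0 < t) (h1 : t ≤ 1) :
    t * Real.log t ∈ Set.Icc (-1) 0 := by
  refine ⟨?_, mul_nonpos_of_nonneg_of_nonpos h0.le (Real.log_nonpos h0.le h1)⟩
  have h := mul_le_mul_of_nonneg_left (Real.one_sub_inv_le_log_of_pos h0) h0.le
  rw [mul_sub, mul_inv_cancel₀ h0.ne'] at h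
  linarith

theorem abs_defectSource_le {x : ℝ} (h0 : 1 / 2 < x) (h1 : x ≤ g) : |defectSource x| ≤ 4 := by
  have hg := g_lt_two_thirds
  have hx : -1 ≤ Real.log x := by
    have hinv : x⁻¹ ≤ 2 := inv_le_of_inv_le₀ two_pos (by linarith)
    linarith [Real.one_sub_inv_le_log_of_pos (show 0 < x by linarith)]
  have hu : -2 ≤ Real.log (1 - x) := by
    have hinv : (1 - x)⁻¹ ≤ 3 := inv_le_of_inv_le₀ three_pos (by linarith)
    linarith [Real.one_sub_inv_le_log_of_pos (show 0 < 1 - x by linarith)]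
  have hx' : Real.log x ≤ 0 := Real.log_nonpos (by linarith) (by linarith)
  have hu' : Real.log (1 - x) ≤ 0 := Real.log_nonpos (by linarith) (by linarith)
  obtain ⟨hxx, hxx'⟩ := mul_log_mem_Icc (show 0 < x by linarith) (by linarith)
  obtain ⟨huu, huu'⟩ := mul_log_mem_Icc (show 0 < 1 - x by linarith) (by linarith)
  obtain ⟨hww, hww'⟩ := mul_log_mem_Icc (show 0 < 2 * x - 1 by linarith) (by linarith)
  rw [defectSource, one_add_mul, one_add_mul, abs_le]
  constructor <;> linarith

/-- Write `u = 1 - x` and `w = 2 x - 1`. The equations at `u` and at `2 - 1/x = w/x` express both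
`F x` and `F (1/x)` through the values of `F` at `w/u` and `u/w = (w/u)⁻¹`. -/
theorem EvenPeriodic.defect_eq {F : ℝ → ℝ} (hF : EvenPeriodic F) {x : ℝ} (h0 : 1 / 2 < x)
    (h1 : x < 1) (hDu : defect F (1 - x) = 0) (hDy : defect F (2 - x⁻¹) = 0) :
    defect F x = defectSource x - (1 - x) * defect F ((1 - x)⁻¹ - 2) := by
  obtain ⟨u, hu⟩ : ∃ u, u = 1 - x := ⟨_, rfl⟩
  obtain ⟨w, hw⟩ : ∃ w, w = 2 * x - 1 := ⟨_, rfl⟩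
  have hx0 : 0 < x := by linarith
  have hu0 : 0 < u := by linarith
  have hw0 : 0 < w := by linarith
  have hv : u⁻¹ - 2 = w / u := by field_simp; linarith
  have hy : 2 - x⁻¹ = w / x := by field_simp; linarith
  have hFx : F x = F u := by
    rw [hu, ← Int.cast_one, hF.intCast_sub]
  have hFu : F u⁻¹ = F (w / u) := by
    rw [← hv, ← Int.cast_ofNat 2, hF.sub_intCast]
  have hFx' : F x⁻¹ = F (w / x) := by
    rw [← hy, ← Int.cast_ofNat 2, hF.intCast_sub]
  have hFy : F (w / x)⁻¹ = F (u / w) := by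
    rw [← hF.periodic (u / w)]
    congr 1
    field_simp
    linarith
  rw [← hu, defect, hFu] at hDu
  rw [hy, defect, hFy, Real.log_div hw0.ne' hx0.ne'] at hDy
  rw [defect, defect, defectSource, ← hu, ← hw, hv, hFx, hFx', inv_div,
    Real.log_div hw0.ne' hu0.ne']
  have hxw : x * (w / x) = w := mul_div_cancel₀ w hx0.ne'
  have huw : u * (w / u) = w := mul_div_cancel₀ w hu0.ne'
  linear_combination hDu + x * hDy + F (u / w) * (huw - hxw) + Real.log w * (hw + hu)

theorem inv_one_sub_sub_two_mem_Ioc {x : ℝ} (h0 : 1 / 2 < x) (h1 : x ≤ g) :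
    (1 - x)⁻¹ - 2 ∈ Set.Ioc 0 g := by
  have hu : 0 < 1 - x := by linarith [g_lt_two_thirds]
  have hlt : (2 : ℝ) < (1 - x)⁻¹ := (lt_inv_comm₀ two_pos hu).2 (by linarith)
  have hle : (1 - x)⁻¹ ≤ 2 + g := by
    rw [inv_le_iff_one_le_mul₀ hu]
    nlinarith [g_sq, g_pos]
  exact ⟨by linarith, by linarith⟩

section HalfDefect

variable {x : ℝ}

theorem Regular.one_sub (hx : Regular x) : Regular (1 - x) := by
  simpa only [Int.cast_one] using hx.intCast_sub 1

theorem Regular.defect_half_eq (hx : Regular x) (h0 : 1 / 2 < x) (h1 : x ≤ g) :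
    defect (wiltonFunction (1 / 2)) x = defectSource x -
      (1 - x) * defect (wiltonFunction (1 / 2)) ((1 - x)⁻¹ - 2) := by
  have hg := g_lt_two_thirds
  have hlt : x⁻¹ < 2 := (inv_lt_comm₀ (by linarith) two_pos).2 (by linarith)
  have hle : 3 / 2 ≤ x⁻¹ := (le_inv_comm₀ (by norm_num) (by linarith)).2 (by linarith)
  have hy : Regular (2 - x⁻¹) := by
    simpa only [Int.cast_ofNat] using (hx.inv_of_le (by linarith) h1).intCast_sub 2
  exact evenPeriodic_wiltonFunction_half.defect_eq h0 (by linarith)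
    (hx.one_sub.defect_wiltonFunction_half ⟨by linarith, by linarith⟩)
    (hy.defect_wiltonFunction_half ⟨by linarith, by linarith⟩)

theorem Regular.inv_one_sub_sub_two_mem_regularSet (hx : Regular x) (h0 : 1 / 2 < x) (h1 : x ≤ g) :
    (1 - x)⁻¹ - 2 ∈ regularSet := by
  have hinv : Regular (1 - x)⁻¹ :=
    hx.one_sub.inv_of_le (by linarith [g_lt_two_thirds]) (by linarith [half_lt_g])
  have hv : Regular ((1 - x)⁻¹ - 2) := by
    simpa only [Int.cast_ofNat] using hinv.sub_intCast 2
  exact ⟨hv, inv_one_sub_sub_two_mem_Ioc h0 h1⟩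

theorem Regular.one_sub_mul_toReal_weight_le (hx : Regular x) (h0 : 1 / 2 < x) (h1 : x ≤ g) :
    (1 - x) * (weight ((1 - x)⁻¹ - 2)).toReal ≤ 9 / 10 * (weight x).toReal := by
  have hv := evenPeriodic_weight.sub_intCast (1 - x)⁻¹ 2
  have hu := evenPeriodic_weight.intCast_sub 1 x
  rw [Int.cast_ofNat] at hv
  rw [Int.cast_one] at hu
  rw [hv, ← hu]
  exact hx.one_sub.mul_toReal_weight_inv_le (by linarith [g_lt_two_thirds])
    (by linarith [half_lt_g])

theorem abs_defect_half_le_weight (hx : x ∈ regularSet) :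
    |defect (wiltonFunction (1 / 2)) x| ≤ 20 * (weight x).toReal := by
  obtain ⟨hreg, h0, h1⟩ := hx
  have hlog : |Real.log x| ≤ (weight x).toReal := by
    rw [abs_of_nonpos (Real.log_nonpos h0.le (by linarith [g_lt_two_thirds]))]
    exact hreg.neg_log_le_toReal_weight h0.le
  have hmul : |x * wiltonFunction (1 / 2) x⁻¹| ≤ 9 * (weight x).toReal := by
    rw [abs_mul, abs_of_pos h0]
    nlinarith [hreg.mul_toReal_weight_inv_le h0 h1,
      (hreg.inv_of_le h0 h1).abs_wiltonFunction_le half_mem_Icc]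
  refine (abs_add_three _ _ _).trans ?_
  linarith [hreg.abs_wiltonFunction_le half_mem_Icc]

theorem abs_defect_half_le_add_pow (n : ℕ) (hx : x ∈ regularSet) :
    |defect (wiltonFunction (1 / 2)) x| ≤ 8 + 20 * ((9 / 10) ^ n * (weight x).toReal) := by
  induction n generalizing x with
  | zero =>
    rw [pow_zero, one_mul]
    linarith [abs_defect_half_le_weight hx]
  | succ n ih =>
    obtain ⟨hreg, h0, h1⟩ := hx
    rcases le_or_gt x (1 / 2) with hle | hlt
    · rw [hreg.defect_wiltonFunction_half ⟨h0, hle⟩, abs_zero]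
      positivity
    have hu : 0 ≤ 1 - x := by linarith [g_lt_two_thirds]
    rw [hreg.defect_half_eq hlt h1]
    set v := (1 - x)⁻¹ - 2
    calc |defectSource x - (1 - x) * defect (wiltonFunction (1 / 2)) v|
        ≤ |defectSource x| + (1 - x) * |defect (wiltonFunction (1 / 2)) v| := by
          refine (abs_sub _ _).trans_eq ?_
          rw [abs_mul, abs_of_nonneg hu]
      _ ≤ 4 + (1 - x) * (8 + 20 * ((9 / 10) ^ n * (weight v).toReal)) := by
          gcongr
          · exact abs_defectSource_le hlt h1
          · exact ih (hreg.inv_one_sub_sub_two_mem_regularSet hlt h1)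
      _ = 4 + (1 - x) * 8 + 20 * ((9 / 10) ^ n * ((1 - x) * (weight v).toReal)) := by ring
      _ ≤ 4 + 1 / 2 * 8 + 20 * ((9 / 10) ^ n * (9 / 10 * (weight x).toReal)) := by
          have hpow : (0 : ℝ) ≤ (9 / 10) ^ n := by positivity
          linarith [mul_le_mul_of_nonneg_left (hreg.one_sub_mul_toReal_weight_le hlt h1) hpow]
      _ = 8 + 20 * ((9 / 10) ^ (n + 1) * (weight x).toReal) := by ring

theorem tendsto_add_mul_pow (a b c : ℝ) :
    Tendsto (fun n : ℕ => a + b * ((9 / 10) ^ n * c)) atTop (𝓝 a) := by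
  have h := tendsto_pow_atTop_nhds_zero_of_lt_one (show (0 : ℝ) ≤ 9 / 10 by norm_num) (by norm_num)
  simpa only [zero_mul, mul_zero, add_zero] using ((h.mul_const c).const_mul b).const_add a

theorem abs_defect_half_le (hx : x ∈ regularSet) : |defect (wiltonFunction (1 / 2)) x| ≤ 8 :=
  ge_of_tendsto' (tendsto_add_mul_pow _ _ _) fun n => abs_defect_half_le_add_pow n hx

end HalfDefect

/-! ### Comparison of `W_α` with `W_{1/2}` -/

section Comparison

variable {α x : ℝ}

/-- Replacing `log (1 / x_j)` by `F(x_j) + x_j F(1 / x_j) - defect F x_j` makes the Wilton sum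
telescope, since `F(1 / x_j) = F(x_{j+1})`. -/
theorem EvenPeriodic.wiltonPartialSum_eq {F : ℝ → ℝ} (hF : EvenPeriodic F)
    (h0 : ∀ j, orbitPoint α x j ≠ 0) (N : ℕ) :
    wiltonPartialSum α N x = F x - (-1) ^ N * betaPrev α x N * F (orbitPoint α x N) -
      ∑ j ∈ Finset.range N, (-1) ^ j * betaPrev α x j * defect F (orbitPoint α x j) := by
  induction N with
  | zero =>
    simp only [wiltonPartialSum, betaPrev, orbitPoint, Finset.sum_range_zero,
      Finset.prod_range_zero, Function.iterate_zero_apply, hF.apply_startPoint]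
    ring
  | succ N ih =>
    unfold wiltonPartialSum at ih ⊢
    rw [Finset.sum_range_succ, ih, Finset.sum_range_succ, betaPrev_succ, orbitPoint_succ,
      hF.apply_nakadaMap (h0 N), wiltonTerm, defect, one_div, Real.log_inv]
    ring

theorem sum_g_pow_le (N : ℕ) : ∑ j ∈ Finset.range N, g ^ j ≤ 3 := by
  have hS : 0 ≤ ∑ j ∈ Finset.range N, g ^ j := Finset.sum_nonneg fun j _ => pow_nonneg g_pos.le j
  nlinarith [geom_sum_mul_neg g N, pow_nonneg g_pos.le N, g_lt_two_thirds]

namespace Regular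

theorem abs_sum_defect_half_le (hx : Regular x) (hα : α ∈ Set.Icc (1 - g) g) (N : ℕ) :
    |∑ j ∈ Finset.range N,
      (-1) ^ j * betaPrev α x j * defect (wiltonFunction (1 / 2)) (orbitPoint α x j)| ≤ 24 := by
  calc _ ≤ ∑ j ∈ Finset.range N, g ^ j * 8 := by
        refine (Finset.abs_sum_le_sum_abs _ _).trans (Finset.sum_le_sum fun j _ => ?_)
        rw [abs_mul, abs_mul, abs_neg_one_pow, one_mul, abs_of_nonneg (hx.betaPrev_nonneg hα j)]
        have hg := g_pos
        gcongr
        · exact hx.betaPrev_le hα j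
        · exact abs_defect_half_le (hx.orbitPoint_mem hα j)
    _ ≤ 3 * 8 := by
        rw [← Finset.sum_mul]
        gcongr
        exact sum_g_pow_le N
    _ = 24 := by norm_num

theorem abs_betaPrev_mul_wiltonFunction_half_le (hx : Regular x) (hα : α ∈ Set.Icc (1 - g) g)
    (N : ℕ) : |(-1) ^ N * betaPrev α x N * wiltonFunction (1 / 2) (orbitPoint α x N)| ≤
      10 * ((9 / 10) ^ N * (weight x).toReal) := by
  have hβ := hx.betaPrev_nonneg hα N
  rw [abs_mul, abs_mul, abs_neg_one_pow, one_mul, abs_of_nonneg hβ]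
  have hF := (hx.orbitPoint_mem hα N).1.abs_wiltonFunction_le half_mem_Icc
  calc betaPrev α x N * |wiltonFunction (1 / 2) (orbitPoint α x N)|
      ≤ betaPrev α x N * (10 * (weight (orbitPoint α x N)).toReal) := by gcongr
    _ = 10 * (betaPrev α x N * (weight (orbitPoint α x N)).toReal) := by ring
    _ ≤ 10 * ((9 / 10) ^ N * (weight x).toReal) := by
        linarith [hx.betaPrev_mul_toReal_weight_le hα N]

theorem abs_wiltonFunction_sub_half_le (hx : Regular x) (hα : α ∈ Set.Icc (1 - g) g) :
    |wiltonFunction α x - wiltonFunction (1 / 2) x| ≤ 24 := by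
  refine le_of_tendsto_of_tendsto' ((hx.tendsto_wiltonPartialSum hα).sub_const _).abs
    (tendsto_add_mul_pow 24 10 (weight x).toReal) fun N => ?_
  rw [evenPeriodic_wiltonFunction_half.wiltonPartialSum_eq
    (fun j => (hx.orbitPoint_mem hα j).2.1.ne'), sub_sub (wiltonFunction (1 / 2) x),
    sub_sub_cancel_left, abs_neg, add_comm (24 : ℝ)]
  exact (abs_add_le _ _).trans (add_le_add (hx.abs_betaPrev_mul_wiltonFunction_half_le hα N)
    (hx.abs_sum_defect_half_le hα N))

end Regular

end Comparison

theorem meanOscLE_wiltonFunction {α : ℝ} (hα : α ∈ Set.Icc (1 - g) g) {a b : ℝ} (hab : a < b) :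
    MeanOscLE (wiltonFunction α) a b (24 + 11 * periodMass (wiltonFunction (1 / 2))) :=
  (isWiltonSolution_wiltonFunction_half.meanOscLE hab).of_enorm_sub_le
    (ae_regular.mono fun x hx => by
      rw [Real.enorm_eq_ofReal_abs, ← ENNReal.ofReal_ofNat]
      exact ENNReal.ofReal_le_ofReal (hx.abs_wiltonFunction_sub_half_le hα))

end Wilton

end

theorem theorem1p1 (α : ℝ) (hα : α ∈ Set.Icc (1 - Wilton.g) Wilton.g) :
    (∀ᵐ x : ℝ ∂MeasureTheory.volume, Wilton.WiltonConverges α x) ∧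
      Wilton.MemBMO (Wilton.wiltonFunction α) := by
  refine ⟨Wilton.ae_regular.mono fun x hx => hx.wiltonConverges hα, ?_⟩
  exact Wilton.memBMO_of_meanOscLE (Wilton.locallyIntegrable_wiltonFunction hα)
    (ENNReal.add_ne_top.2 ⟨ENNReal.ofNat_ne_top,
      ENNReal.mul_ne_top ENNReal.ofNat_ne_top Wilton.periodMass_wiltonFunction_half_ne_top⟩)
    fun _ _ hab => Wilton.meanOscLE_wiltonFunction hα hab
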